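/- Let $k,\ell\ge 1$ be integers and write $[2k]=\{1,\dots,2k\}$. A channel $W\colon[2k]\to\{0,1\}^\ell$ is a randomized function that outputs $y\in\{0,1\}^\ell$ on input $x\in[2k]$ with probability $W(y\mid x)$. In a (sequentially) interactive protocol with $\ell$-bit messages, $n$ users observe independent samples $X_1,\dots,X_n$ from an unknown distribution $p$ on $[2k]$. There are public coins $U$ (an arbitrary random variable independent of the samples). For $t=1,\dots,n$, user $t$ selects an arbitrary channel $W_t\colon[2k]\to\{0,1\}^\ell$ as a function of $(Y_1,\dots,Y_{t-1},U)$ and sends a message $Y_t$, which equals $y$ with probability $W_t(y\mid X_t)$. An $(n,\varepsilon)$-test for uniformity is such a protocol for $n$ users together with a randomized decision function $T(Y_1,\dots,Y_n,U)\in\{0,1\}$ for which $\Pr[T=0]\ge 99/100$ when $p$ is the uniform distribution $u$ on $[2k]$, and $\Pr[T=1]\ge 99/100$ for every $p$ with total variation distance $\sup_{S\subseteq[2k]}(p(S)-u(S))\ge\varepsilon$. The sample complexity of interactive $(2k,\varepsilon)$-uniformity testing with $\ell$-bit messages is the least $n$ for which an $(n,\varepsilon)$-test exists. There is an absolute constant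 $C>0$ such that for all integers $k,\ell$ with $1\le\ell\le\log_2 k$ and all $\varepsilon\in(0,1/4]$, the sample complexity of interactive $(2k,\varepsilon)$-uniformity testing with $\ell$-bit messages is at least $$C\cdot\frac{k}{\varepsilon^2\,2^{\ell/2}}.$$ -/

import Mathlib

open scoped ENNReal
open MeasureTheory

universe u

/-- A channel `W : X → Y`: a randomized function, where `W.prob x y` is the probability `W(y ∣ x)`
that the output is `y` when the input is `x`. -/
structure Channel (X Y : Type*) [Fintype Y] where
  prob : X → Y → ℝ
  prob_mem : ∀ x, prob x ∈ stdSimplex ℝ Y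

/-- The communication constraint: all channels from `[2k]` (written `Fin (2 * k)`) whose messages
are strings of `ℓ` bits. -/
def commChannels (k ℓ : ℕ) : Set (Channel (Fin (2 * k)) (Fin ℓ → Bool)) := Set.univ

/-- The part of a transcript `y` of `n` messages that comes before user `t`. -/
def pastMessages {Y : Type*} {n : ℕ} (y : Fin n → Y) (t : Fin n) : Fin t → Y :=
  fun i => y (Fin.castLE t.isLt.le i)

/-- A sequentially interactive protocol for `n` users with channels in `𝒲` and public coins in `U`:
user `t` selects a channel in `𝒲` as a function of the messages of the previous users and of the
public coins. -/
structure InteractiveProtocol {X Y : Type*} [Fintype Y] (𝒲 : Set (Channel X Y)) (n : ℕ)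
    (U : Type u) [MeasurableSpace U] where
  channel : (t : Fin n) → (Fin t → Y) → U → Channel X Y
  channel_mem : ∀ t past c, channel t past c ∈ 𝒲
  measurable_prob : ∀ t past x y, Measurable fun c => (channel t past c).prob x y

/-- The conditional probability, given that the public coins are `c`, that the transcript of the
messages is `y`, when the users' inputs are independent samples from `p`. Given the inputs `x`,
user `t` sends `y t` with probability `W(y t ∣ x t)`, where `W` is the channel that the user
selects. -/
noncomputable def InteractiveProtocol.transcriptProb {X Y : Type*} [Fintype X] [Fintype Y]
    {𝒲 : Set (Channel X Y)} {n : ℕ} {U : Type u} [MeasurableSpace U]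
    (P : InteractiveProtocol 𝒲 n U) (p : X → ℝ) (c : U) (y : Fin n → Y) : ℝ :=
  ∑ x : Fin n → X,
    (∏ t, p (x t)) * ∏ t, (P.channel t (pastMessages y t) c).prob (x t) (y t)

/-- A randomized decision function of the messages and the public coins, with values in `Bool`
(`false` stands for the output `0`, "accept", and `true` for the output `1`, "reject"). -/
structure DecisionFunction (Y : Type*) (n : ℕ) (U : Type u) [MeasurableSpace U] where
  decide : U → Channel (Fin n → Y) Bool
  measurable_prob : ∀ y b, Measurable fun c => (decide c).prob y b

/-- The probability that the decision is `b`, when the users' inputs are independent samples from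
`p` and the public coins have law `μ`, independently of the inputs. -/
noncomputable def decisionProb {X Y : Type*} [Fintype X] [Fintype Y]
    {𝒲 : Set (Channel X Y)} {n : ℕ} {U : Type u} [MeasurableSpace U] (μ : Measure U)
    (P : InteractiveProtocol 𝒲 n U) (T : DecisionFunction Y n U) (p : X → ℝ) (b : Bool) : ℝ :=
  ∫ c, ∑ y : Fin n → Y, P.transcriptProb p c y * (T.decide c).prob y b ∂μ

/-- The total variation distance `sup_S (p(S) - q(S))`. -/
noncomputable def tvDist {X : Type*} (p q : X → ℝ) : ℝ :=
  ⨆ S : Finset X, (∑ x ∈ S, p x - ∑ x ∈ S, q x)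

/-- The uniform distribution. -/
noncomputable def uniformDist (X : Type*) [Fintype X] : X → ℝ :=
  fun _ => 1 / (Fintype.card X : ℝ)

/-- An interactive protocol and a decision function form an `(n, ε)`-test for uniformity. -/
def IsUniformityTest {X Y : Type*} [Fintype X] [Fintype Y]
    {𝒲 : Set (Channel X Y)} {n : ℕ} {U : Type u} [MeasurableSpace U] (μ : Measure U)
    (P : InteractiveProtocol 𝒲 n U) (T : DecisionFunction Y n U) (ε : ℝ) : Prop :=
  99 / 100 ≤ decisionProb μ P T (uniformDist X) false ∧
    ∀ p ∈ stdSimplex ℝ X, ε ≤ tvDist p (uniformDist X) → 99 / 100 ≤ decisionProb μ P T p true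

/-- The sample complexity of interactive uniformity testing using `𝒲`: the least number `n` of
users for which there is an `(n, ε)`-test, for some probability space of public coins
(`⊤` if there is no such `n`). -/
noncomputable def uniformitySampleComplexity {X Y : Type*} [Fintype X] [Fintype Y]
    (𝒲 : Set (Channel X Y)) (ε : ℝ) : ℕ∞ :=
  sInf ((fun n : ℕ => (n : ℕ∞)) '' {n : ℕ |
    ∃ (U : Type u) (_ : MeasurableSpace U) (μ : Measure U) (_ : IsProbabilityMeasure μ)
      (P : InteractiveProtocol 𝒲 n U) (T : DecisionFunction Y n U), IsUniformityTest μ P T ε})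

/-! Split the domain into `k` pairs and, with `γ = 2ε`, give the two elements of pair `i` the masses
`(1 ± γ z i) / (2k)`, where `z` is a uniformly random vector of signs. Each such distribution is
`ε`-far from uniform, so a test must tell the law of the transcript under uniform inputs from its
average over `z`. By `condDecisionProb_add_average_le` this is impossible if the divergence of the
average from the uniform law is at most `1/16`.

The chain rule splits this divergence over the users. An output law is affine in `z`, so, given the
past, averaging over `z` puts the posterior mean `m` in place of `z` (`mixProb_snoc`), and the next
message costs at most `γ² ‖m‖² / k` (`Channel.sum_sq_output_sub_div_le`). What remains is how much
the transcript reveals about single signs. The size of `m i` is controlled by how much flipping `z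
i` changes the law of the transcript. For one channel with `2 ^ ℓ` outputs these changes, summed
over `i`, cost at most `8 γ² 2 ^ ℓ / k` (`Channel.sum_chiSq_flipAt_le`), whatever the past. A second
chain rule gives `E ‖m‖² ≤ 8 t γ² 2 ^ ℓ / k` after `t` messages
(`sum_mixProb_mul_sq_posteriorMean_le`).

Summing over `t < n` bounds the divergence by `4 γ⁴ n² 2 ^ ℓ / k²` (`klSum_mixProb_le`). This must
exceed `1/16`, which forces `n` to be of order `k / (ε² 2 ^ (ℓ / 2))`. Public coins are fixed first
and integrated out at the end. -/

/-! ### Divergence inequalities and the chain rule -/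

section Divergence

variable {S : Type*} [Fintype S]

/-- The Kullback–Leibler divergence of two nonnegative functions on a finite type. -/
noncomputable def klSum (A B : S → ℝ) : ℝ :=
  ∑ s, A s * Real.log (A s / B s)

/-- Both sides are compared with the Hellinger term `(√a - √b)²`. -/
lemma sq_sub_div_add_le_two_mul_kl {a b : ℝ} (ha : 0 ≤ a) (hb : 0 ≤ b) (hab : b = 0 → a = 0) :
    (a - b) ^ 2 / (a + b) ≤ 2 * (a * Real.log (a / b) - a + b) := by
  rcases hb.eq_or_lt with rfl | hb
  · simp [hab rfl]
  rcases ha.eq_or_lt with rfl | ha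
  · have h : b ^ 2 / b = b := by field_simp
    simp only [zero_sub, neg_sq, zero_add, zero_mul]
    rw [h]
    linarith
  obtain ⟨s, hs, rfl⟩ : ∃ s : ℝ, 0 < s ∧ s ^ 2 = a := ⟨√a, Real.sqrt_pos.2 ha, Real.sq_sqrt ha.le⟩
  obtain ⟨r, hr, rfl⟩ : ∃ r : ℝ, 0 < r ∧ r ^ 2 = b := ⟨√b, Real.sqrt_pos.2 hb, Real.sq_sqrt hb.le⟩
  have hlog : Real.log (s ^ 2 / r ^ 2) = -2 * Real.log (r / s) := by
    rw [← div_pow, Real.log_pow, ← inv_div r s, Real.log_inv]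
    push_cast
    ring
  have h1 : Real.log (r / s) ≤ r / s - 1 := Real.log_le_sub_one_of_pos (by positivity)
  have h2 : 2 * s ^ 2 - 2 * s * r ≤ s ^ 2 * Real.log (s ^ 2 / r ^ 2) := by
    rw [hlog]
    have h3 : s ^ 2 * Real.log (r / s) ≤ s ^ 2 * (r / s - 1) := by gcongr
    have h4 : s ^ 2 * (r / s - 1) = s * r - s ^ 2 := by field_simp
    linarith
  rw [div_le_iff₀ (by positivity)]
  have h5 : (s - r) ^ 2 ≤ s ^ 2 * Real.log (s ^ 2 / r ^ 2) - s ^ 2 + r ^ 2 := by linarith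
  calc (s ^ 2 - r ^ 2) ^ 2 ≤ 2 * (s - r) ^ 2 * (s ^ 2 + r ^ 2) := by
        have : 2 * (s - r) ^ 2 * (s ^ 2 + r ^ 2) - (s ^ 2 - r ^ 2) ^ 2 = ((s - r) ^ 2) ^ 2 := by ring
        linarith [sq_nonneg ((s - r) ^ 2)]
    _ ≤ _ := by gcongr

lemma sum_sq_sub_div_add_le_two_mul_klSum {A B : S → ℝ} (hA : ∀ s, 0 ≤ A s) (hB : ∀ s, 0 ≤ B s)
    (hAB : ∀ s, B s = 0 → A s = 0) (h : ∑ s, A s = ∑ s, B s) :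
    ∑ s, (A s - B s) ^ 2 / (A s + B s) ≤ 2 * klSum A B := by
  calc ∑ s, (A s - B s) ^ 2 / (A s + B s)
      ≤ ∑ s, 2 * (A s * Real.log (A s / B s) - A s + B s) :=
        Finset.sum_le_sum fun s _ => sq_sub_div_add_le_two_mul_kl (hA s) (hB s) (hAB s)
    _ = 2 * klSum A B := by
        rw [← Finset.mul_sum, Finset.sum_add_distrib, Finset.sum_sub_distrib, h, klSum]
        ring

/-- A Pinsker-type bound for a randomized test `T`: Cauchy–Schwarz with weights `A + B`, of total
mass `2`, reduces it to the triangular discrimination. -/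
lemma sq_sum_sub_mul_le_four_mul_klSum {A B T : S → ℝ} (hA : ∀ s, 0 ≤ A s) (hB : ∀ s, 0 ≤ B s)
    (hAB : ∀ s, B s = 0 → A s = 0) (hA1 : ∑ s, A s = 1) (hB1 : ∑ s, B s = 1)
    (hT0 : ∀ s, 0 ≤ T s) (hT1 : ∀ s, T s ≤ 1) :
    (∑ s, (B s - A s) * T s) ^ 2 ≤ 4 * klSum A B := by
  have h1 : (∑ s, (B s - A s) * T s) ^ 2 ≤
      (∑ s, (A s - B s) ^ 2 / (A s + B s)) * ∑ s, (A s + B s) * T s ^ 2 := by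
    refine Finset.sum_sq_le_sum_mul_sum_of_sq_le_mul _ (fun s _ => ?_) (fun s _ => ?_)
      (fun s _ => le_of_eq ?_)
    · exact div_nonneg (sq_nonneg _) (add_nonneg (hA s) (hB s))
    · exact mul_nonneg (add_nonneg (hA s) (hB s)) (sq_nonneg _)
    · rcases eq_or_ne (A s + B s) 0 with h0 | h0
      · have h1 : A s = 0 := by linarith [hA s, hB s]
        have h2 : B s = 0 := by linarith [hA s, hB s]
        simp [h1, h2]
      · field_simp
        ring
  have h2 : ∑ s, (A s + B s) * T s ^ 2 ≤ 2 := by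
    calc ∑ s, (A s + B s) * T s ^ 2 ≤ ∑ s, (A s + B s) := by
          refine Finset.sum_le_sum fun s _ => mul_le_of_le_one_right (add_nonneg (hA s) (hB s)) ?_
          exact pow_le_one₀ (hT0 s) (hT1 s)
      _ = 2 := by rw [Finset.sum_add_distrib, hA1, hB1]; norm_num
  have h3 := sum_sq_sub_div_add_le_two_mul_klSum hA hB hAB (hA1.trans hB1.symm)
  have h4 : 0 ≤ ∑ s, (A s - B s) ^ 2 / (A s + B s) :=
    Finset.sum_nonneg fun s _ => div_nonneg (sq_nonneg _) (add_nonneg (hA s) (hB s))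
  nlinarith

lemma sum_mul_log_le_add_chiSq {Y : Type*} [Fintype Y] {A B : ℝ} {a b : Y → ℝ} (hA : 0 ≤ A)
    (hB : 0 ≤ B) (hAB : B = 0 → A = 0) (ha : ∀ c, 0 ≤ a c) (hb : ∀ c, 0 ≤ b c)
    (hab : ∀ c, b c = 0 → a c = 0) (ha1 : ∑ c, a c = 1) (hb1 : ∑ c, b c = 1) :
    ∑ c, (A * a c) * Real.log ((A * a c) / (B * b c)) ≤
      A * Real.log (A / B) + A * ∑ c, (a c - b c) ^ 2 / b c := by
  rcases hA.eq_or_lt with rfl | hA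
  · simp
  have hB : 0 < B := hB.lt_of_ne fun h => hA.ne' (hAB h.symm)
  -- The correction `A * (a c - b c)` comes from `log x ≤ x - 1` and cancels on summation over `c`.
  have key : ∀ c, (A * a c) * Real.log ((A * a c) / (B * b c)) ≤
      a c * (A * Real.log (A / B)) + A * ((a c - b c) ^ 2 / b c) + A * (a c - b c) := by
    intro c
    rcases (hb c).eq_or_lt with h | hbc
    · simp [← h, hab c h.symm]
    rcases (ha c).eq_or_lt with h | hac
    · have h2 : b c ^ 2 / b c = b c := by field_simp
      simp [← h, h2]
    have h1 : (A * a c) / (B * b c) = (A / B) * (a c / b c) := by field_simp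
    rw [h1, Real.log_mul (by positivity) (by positivity)]
    have h2 : Real.log (a c / b c) ≤ a c / b c - 1 := Real.log_le_sub_one_of_pos (by positivity)
    have h3 : A * a c * Real.log (a c / b c) ≤ A * a c * (a c / b c - 1) := by gcongr
    have h4 : A * a c * (a c / b c - 1) = A * ((a c - b c) ^ 2 / b c) + A * (a c - b c) := by
      field_simp
      ring
    linarith
  refine (Finset.sum_le_sum fun c _ => key c).trans (le_of_eq ?_)
  rw [Finset.sum_add_distrib, Finset.sum_add_distrib, ← Finset.sum_mul, ← Finset.mul_sum,
    ← Finset.mul_sum, Finset.sum_sub_distrib, ha1, hb1]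
  ring

lemma sum_snoc {Y : Type*} [Fintype Y] {t : ℕ} (f : (Fin (t + 1) → Y) → ℝ) :
    ∑ y, f y = ∑ y : Fin t → Y, ∑ c, f (Fin.snoc y c) := by
  rw [← (Fin.snocEquiv fun _ : Fin (t + 1) => Y).sum_comp, Fintype.sum_prod_type_right]
  rfl

/-- The chain rule for the Kullback–Leibler divergence, with the divergence of the conditional
distributions bounded by their chi-square divergence. -/
lemma klSum_snoc_le {Y : Type*} [Fintype Y] {t : ℕ} {A B : (Fin t → Y) → ℝ}
    {A' B' : (Fin (t + 1) → Y) → ℝ} {a b : (Fin t → Y) → Y → ℝ}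
    (hA' : ∀ y c, A' (Fin.snoc y c) = A y * a y c) (hB' : ∀ y c, B' (Fin.snoc y c) = B y * b y c)
    (hA : ∀ y, 0 ≤ A y) (hB : ∀ y, 0 ≤ B y) (hAB : ∀ y, B y = 0 → A y = 0)
    (ha : ∀ y c, 0 ≤ a y c) (hb : ∀ y c, 0 ≤ b y c) (hab : ∀ y c, b y c = 0 → a y c = 0)
    (ha1 : ∀ y, ∑ c, a y c = 1) (hb1 : ∀ y, ∑ c, b y c = 1) :
    klSum A' B' ≤ klSum A B + ∑ y, A y * ∑ c, (a y c - b y c) ^ 2 / b y c := by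
  rw [klSum, sum_snoc, klSum, ← Finset.sum_add_distrib]
  refine Finset.sum_le_sum fun y _ => ?_
  simp only [hA', hB']
  exact sum_mul_log_le_add_chiSq (hA y) (hB y) (hAB y) (ha y) (hb y) (hab y) (ha1 y) (hb1 y)

end Divergence

/-! ### Sign vectors and coordinate flips -/

section Signs

variable {ι : Type*}

/-- The signs `1` and `-1`, indexed by `true` and `false`. -/
def boolSign (b : Bool) : ℝ := if b then 1 else -1

lemma boolSign_not (b : Bool) : boolSign (!b) = -boolSign b := by
  cases b <;> simp [boolSign]

lemma abs_boolSign (b : Bool) : |boolSign b| = 1 := by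
  cases b <;> simp [boolSign]

/-- The vector of signs of `z`. -/
def signVec (z : ι → Bool) (i : ι) : ℝ := boolSign (z i)

/-- The vector `z` with the entry at `i` flipped. -/
def flipAt [DecidableEq ι] (z : ι → Bool) (i : ι) : ι → Bool := Function.update z i (!z i)

lemma abs_signVec_le (z : ι → Bool) (i : ι) : |signVec z i| ≤ 1 := (abs_boolSign _).le

lemma flipAt_involutive [DecidableEq ι] (i : ι) :
    Function.Involutive fun z : ι → Bool => flipAt z i := by
  intro z
  simp [flipAt]

end Signs

/-! ### One message: effect of the perturbation on the output law -/

section Perturbation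

variable {ι Y : Type*} [Fintype ι] [Fintype Y]

/-- The distribution on pairs obtained from the uniform one by moving, for each `i`, mass
proportional to `γ * v i` between the two elements of the pair `i`. -/
noncomputable def perturbed (γ : ℝ) (v : ι → ℝ) (x : Bool × ι) : ℝ :=
  (1 + γ * boolSign x.1 * v x.2) / (2 * Fintype.card ι)

namespace Channel

variable (W : Channel (Bool × ι) Y)

/-- The contribution of the pair `i` to the probability of the output `c` on uniform input. -/
noncomputable def pairMass (i : ι) (c : Y) : ℝ :=
  (W.prob (true, i) c + W.prob (false, i) c) / (2 * Fintype.card ι)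

/-- The normalized difference of the output probabilities on the two elements of the pair `i`. -/
noncomputable def pairDiff (i : ι) (c : Y) : ℝ :=
  (W.prob (true, i) c - W.prob (false, i) c) / (2 * Fintype.card ι)

/-- The probability of the output `c` on an input with distribution `perturbed γ v`. -/
noncomputable def output (γ : ℝ) (v : ι → ℝ) (c : Y) : ℝ :=
  ∑ i, (W.pairMass i c + γ * v i * W.pairDiff i c)

lemma sum_perturbed_mul_prob (γ : ℝ) (v : ι → ℝ) (c : Y) :
    ∑ x, perturbed γ v x * W.prob x c = W.output γ v c := by
  rw [Fintype.sum_prod_type_right, output]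
  refine Finset.sum_congr rfl fun i _ => ?_
  simp [perturbed, boolSign, pairMass, pairDiff]
  ring

lemma pairMass_nonneg (i : ι) (c : Y) : 0 ≤ W.pairMass i c :=
  div_nonneg (add_nonneg ((W.prob_mem _).1 c) ((W.prob_mem _).1 c)) (by positivity)

lemma abs_pairDiff_le (i : ι) (c : Y) : |W.pairDiff i c| ≤ W.pairMass i c := by
  have h1 := (W.prob_mem (true, i)).1 c
  have h2 := (W.prob_mem (false, i)).1 c
  rw [pairDiff, pairMass, abs_div, abs_of_nonneg (by positivity : (0 : ℝ) ≤ 2 * Fintype.card ι)]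
  gcongr
  rw [abs_le]
  constructor <;> linarith

lemma sum_pairMass (i : ι) : ∑ c, W.pairMass i c = 1 / Fintype.card ι := by
  simp only [pairMass]
  rw [← Finset.sum_div, Finset.sum_add_distrib, (W.prob_mem _).2, (W.prob_mem _).2]
  ring

lemma sum_pairDiff (i : ι) : ∑ c, W.pairDiff i c = 0 := by
  simp only [pairDiff]
  rw [← Finset.sum_div, Finset.sum_sub_distrib, (W.prob_mem _).2, (W.prob_mem _).2]
  ring

lemma prob_le_one {X : Type*} (V : Channel X Y) (x : X) (c : Y) : V.prob x c ≤ 1 := by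
  rw [← (V.prob_mem x).2]
  exact Finset.single_le_sum (fun c _ => (V.prob_mem x).1 c) (Finset.mem_univ c)

lemma pairMass_le (i : ι) (c : Y) : W.pairMass i c ≤ 1 / Fintype.card ι := by
  rw [← W.sum_pairMass i]
  exact Finset.single_le_sum (fun c _ => W.pairMass_nonneg i c) (Finset.mem_univ c)

lemma sum_output [Nonempty ι] (γ : ℝ) (v : ι → ℝ) : ∑ c, W.output γ v c = 1 := by
  simp only [output]
  rw [Finset.sum_comm]
  simp only [Finset.sum_add_distrib, ← Finset.mul_sum, sum_pairMass, sum_pairDiff]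
  simp

lemma output_zero (γ : ℝ) (c : Y) : W.output γ 0 c = ∑ i, W.pairMass i c := by
  simp [output]

lemma output_zero_nonneg (γ : ℝ) (c : Y) : 0 ≤ W.output γ 0 c := by
  rw [output_zero]
  exact Finset.sum_nonneg fun i _ => W.pairMass_nonneg i c

variable {γ : ℝ} {v : ι → ℝ}

lemma abs_perturbation_le (hγ0 : 0 ≤ γ) (hγ : γ ≤ 1 / 2) (hv : ∀ i, |v i| ≤ 1) (i : ι) (c : Y) :
    |γ * v i * W.pairDiff i c| ≤ W.pairMass i c / 2 := by
  rw [abs_mul, abs_mul, abs_of_nonneg hγ0]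
  calc γ * |v i| * |W.pairDiff i c| ≤ 1 / 2 * 1 * W.pairMass i c := by
        gcongr
        · exact hv i
        · exact W.abs_pairDiff_le i c
    _ = _ := by ring

lemma half_output_zero_le (hγ0 : 0 ≤ γ) (hγ : γ ≤ 1 / 2) (hv : ∀ i, |v i| ≤ 1) (c : Y) :
    W.output γ 0 c / 2 ≤ W.output γ v c := by
  rw [output_zero, output, Finset.sum_div]
  refine Finset.sum_le_sum fun i _ => ?_
  have := (abs_le.1 (W.abs_perturbation_le hγ0 hγ hv i c)).1
  linarith

lemma output_le (hγ0 : 0 ≤ γ) (hγ : γ ≤ 1 / 2) (hv : ∀ i, |v i| ≤ 1) (c : Y) :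
    W.output γ v c ≤ 3 / 2 * W.output γ 0 c := by
  rw [output_zero, output, Finset.mul_sum]
  refine Finset.sum_le_sum fun i _ => ?_
  have := (abs_le.1 (W.abs_perturbation_le hγ0 hγ hv i c)).2
  linarith

lemma output_nonneg (hγ0 : 0 ≤ γ) (hγ : γ ≤ 1 / 2) (hv : ∀ i, |v i| ≤ 1) (c : Y) :
    0 ≤ W.output γ v c := by
  linarith [W.half_output_zero_le hγ0 hγ hv c, W.output_zero_nonneg γ c]

/-- All perturbed output laws lie within constant factors of the uniform one, hence share its
support; this supplies the absolute continuity needed for the divergences. -/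
lemma output_eq_zero {v' : ι → ℝ} (hγ0 : 0 ≤ γ) (hγ : γ ≤ 1 / 2) (hv : ∀ i, |v i| ≤ 1)
    (hv' : ∀ i, |v' i| ≤ 1) {c : Y} (h : W.output γ v' c = 0) : W.output γ v c = 0 := by
  linarith [W.half_output_zero_le hγ0 hγ hv' c, W.output_zero_nonneg γ c,
    W.output_le hγ0 hγ hv c, W.output_nonneg hγ0 hγ hv c]

/-- The chi-square divergence between a perturbed and the uniform output distribution. -/
lemma sum_sq_output_sub_div_le (γ : ℝ) (v : ι → ℝ) :
    ∑ c, (W.output γ v c - W.output γ 0 c) ^ 2 / W.output γ 0 c ≤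
      γ ^ 2 / Fintype.card ι * ∑ i, v i ^ 2 := by
  have key : ∀ c, (W.output γ v c - W.output γ 0 c) ^ 2 / W.output γ 0 c ≤
      γ ^ 2 * ∑ i, v i ^ 2 * W.pairMass i c := by
    intro c
    have hnn : 0 ≤ γ ^ 2 * ∑ i, v i ^ 2 * W.pairMass i c :=
      mul_nonneg (sq_nonneg _) (Finset.sum_nonneg fun i _ =>
        mul_nonneg (sq_nonneg _) (W.pairMass_nonneg i c))
    rcases (W.output_zero_nonneg γ c).eq_or_lt with h | h
    · simpa [← h] using hnn
    rw [div_le_iff₀ h]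
    have h1 : W.output γ v c - W.output γ 0 c = γ * ∑ i, v i * W.pairDiff i c := by
      rw [output_zero, output, ← Finset.sum_sub_distrib, Finset.mul_sum]
      exact Finset.sum_congr rfl fun i _ => by ring
    rw [h1, mul_pow, mul_assoc]
    gcongr
    have h2 : |∑ i, v i * W.pairDiff i c| ≤ ∑ i, |v i| * W.pairMass i c :=
      (Finset.abs_sum_le_sum_abs _ _).trans (Finset.sum_le_sum fun i _ => by
        rw [abs_mul]
        exact mul_le_mul_of_nonneg_left (W.abs_pairDiff_le i c) (abs_nonneg _))
    rw [← sq_abs, output_zero]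
    refine (pow_le_pow_left₀ (abs_nonneg _) h2 2).trans ?_
    -- Cauchy–Schwarz with weights `pairMass`, whose sum over `i` is the denominator being
    -- cancelled.
    refine Finset.sum_sq_le_sum_mul_sum_of_sq_le_mul _ (fun i _ => ?_) (fun i _ => ?_)
      (fun i _ => le_of_eq ?_)
    · exact mul_nonneg (sq_nonneg _) (W.pairMass_nonneg i c)
    · exact W.pairMass_nonneg i c
    · rw [mul_pow, sq_abs]
      ring
  refine (Finset.sum_le_sum fun c _ => key c).trans (le_of_eq ?_)
  rw [← Finset.mul_sum, Finset.sum_comm]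
  simp only [← Finset.mul_sum, sum_pairMass]
  rw [← Finset.sum_mul]
  ring

/-- The factor `W.output γ 0 c` cancels the chi-square denominator, so every output symbol
contributes the same amount, however unlikely it is; hence the factor `Fintype.card Y` later. -/
lemma sum_sq_pairDiff_le (c : Y) :
    ∑ i, W.pairDiff i c ^ 2 ≤ W.output γ 0 c / Fintype.card ι := by
  rw [output_zero, Finset.sum_div]
  refine Finset.sum_le_sum fun i _ => ?_
  rw [← sq_abs]
  calc |W.pairDiff i c| ^ 2 ≤ W.pairMass i c ^ 2 :=
        pow_le_pow_left₀ (abs_nonneg _) (W.abs_pairDiff_le i c) 2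
    _ = W.pairMass i c * W.pairMass i c := sq _
    _ ≤ W.pairMass i c * (1 / Fintype.card ι) := by
        gcongr
        · exact W.pairMass_nonneg i c
        · exact W.pairMass_le i c
    _ = _ := by ring

variable [DecidableEq ι]

lemma output_sub_output_flipAt (γ : ℝ) (z : ι → Bool) (i : ι) (c : Y) :
    W.output γ (signVec z) c - W.output γ (signVec (flipAt z i)) c =
      2 * γ * boolSign (z i) * W.pairDiff i c := by
  rw [output, output, ← Finset.sum_sub_distrib, Finset.sum_eq_single i]
  · simp only [signVec, flipAt, Function.update_self, boolSign_not]
    ring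
  · intro j _ hj
    simp [signVec, flipAt, Function.update_of_ne hj]
  · simp

/-- The sum over all coordinates of the chi-square divergences caused by flipping the sign at the
coordinate. -/
lemma sum_chiSq_flipAt_le (hγ0 : 0 ≤ γ) (hγ : γ ≤ 1 / 2) (z : ι → Bool) :
    ∑ i, ∑ c, (W.output γ (signVec z) c - W.output γ (signVec (flipAt z i)) c) ^ 2 /
        W.output γ (signVec (flipAt z i)) c ≤
      8 * γ ^ 2 * Fintype.card Y / Fintype.card ι := by
  rw [Finset.sum_comm]
  have key : ∀ c, ∑ i, (W.output γ (signVec z) c - W.output γ (signVec (flipAt z i)) c) ^ 2 /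
      W.output γ (signVec (flipAt z i)) c ≤ 8 * γ ^ 2 / Fintype.card ι := by
    intro c
    rcases (W.output_zero_nonneg γ c).eq_or_lt with h | h
    · have h0 : ∀ i, W.output γ (signVec (flipAt z i)) c = 0 := fun i =>
        W.output_eq_zero hγ0 hγ (abs_signVec_le _) (v' := 0) (by simp) h.symm
      simp only [h0, div_zero, Finset.sum_const_zero]
      positivity
    calc _ ≤ ∑ i, 8 * γ ^ 2 / W.output γ 0 c * W.pairDiff i c ^ 2 := by
          refine Finset.sum_le_sum fun i _ => ?_
          -- Replacing the denominator by half the uniform output turns the constant `4` into `8`.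
          have h1 := W.half_output_zero_le hγ0 hγ (abs_signVec_le (flipAt z i)) c
          rw [output_sub_output_flipAt]
          have h2 : boolSign (z i) ^ 2 = 1 := by rw [← sq_abs, abs_boolSign, one_pow]
          have h3 : (2 * γ * boolSign (z i) * W.pairDiff i c) ^ 2 =
              4 * γ ^ 2 * W.pairDiff i c ^ 2 := by
            rw [mul_pow, mul_pow, h2]
            ring
          rw [h3]
          calc _ ≤ 4 * γ ^ 2 * W.pairDiff i c ^ 2 / (W.output γ 0 c / 2) := by gcongr
            _ = _ := by
              field_simp
              ring
      _ ≤ 8 * γ ^ 2 / W.output γ 0 c * (W.output γ 0 c / Fintype.card ι) := by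
          rw [← Finset.mul_sum]
          gcongr
          exact W.sum_sq_pairDiff_le c
      _ = _ := by field_simp
  refine (Finset.sum_le_sum fun c _ => key c).trans (le_of_eq ?_)
  rw [Finset.sum_const, Finset.card_univ, nsmul_eq_mul]
  ring

end Channel

end Perturbation

/-! ### Transcripts: posterior means and accumulated divergence -/

section Paths

variable {ι Y : Type*} [Fintype ι] [Fintype Y]

/-- The probability of the transcript `y` of `t` messages, when user `s` uses the channel selected
by `W` as a function of the past messages and the inputs have distribution `perturbed γ v`. -/
noncomputable def pathProb (W : ∀ t, (Fin t → Y) → Channel (Bool × ι) Y) (γ : ℝ) (v : ι → ℝ)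
    (t : ℕ) (y : Fin t → Y) : ℝ :=
  ∏ s : Fin t, (W s (pastMessages y s)).output γ v (y s)

variable (W : ∀ t, (Fin t → Y) → Channel (Bool × ι) Y) {γ : ℝ} {v : ι → ℝ}

lemma pathProb_snoc (γ : ℝ) (v : ι → ℝ) (t : ℕ) (y : Fin t → Y) (c : Y) :
    pathProb W γ v (t + 1) (Fin.snoc y c) = pathProb W γ v t y * (W t y).output γ v c := by
  have h1 : ∀ s : Fin t, pastMessages (Fin.snoc (α := fun _ => Y) y c) s.castSucc =
      pastMessages y s := by
    intro s
    funext j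
    exact Fin.snoc_castSucc (α := fun _ => Y) c y (Fin.castLE s.isLt.le j)
  have h2 : pastMessages (Fin.snoc (α := fun _ => Y) y c) (Fin.last t) = y := by
    funext j
    exact Fin.snoc_castSucc (α := fun _ => Y) c y j
  rw [pathProb, Fin.prod_univ_castSucc, pathProb]
  congr 1
  · refine Finset.prod_congr rfl fun s _ => ?_
    rw [h1, Fin.snoc_castSucc]
    rfl
  · rw [h2, Fin.snoc_last]
    rfl

lemma sum_pathProb [Nonempty ι] (γ : ℝ) (v : ι → ℝ) (t : ℕ) : ∑ y, pathProb W γ v t y = 1 := by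
  induction t with
  | zero => simp [pathProb]
  | succ t ih =>
    rw [sum_snoc]
    simp only [pathProb_snoc, ← Finset.mul_sum, Channel.sum_output, mul_one]
    exact ih

section

variable (hγ0 : 0 ≤ γ) (hγ : γ ≤ 1 / 2)
include hγ0 hγ

lemma pathProb_nonneg (hv : ∀ i, |v i| ≤ 1) (t : ℕ) (y : Fin t → Y) : 0 ≤ pathProb W γ v t y :=
  Finset.prod_nonneg fun _ _ => Channel.output_nonneg _ hγ0 hγ hv _

lemma pathProb_eq_zero {v' : ι → ℝ} (hv : ∀ i, |v i| ≤ 1) (hv' : ∀ i, |v' i| ≤ 1) {t : ℕ}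
    {y : Fin t → Y} (h : pathProb W γ v' t y = 0) : pathProb W γ v t y = 0 := by
  obtain ⟨s, hs, h0⟩ := Finset.prod_eq_zero_iff.1 h
  exact Finset.prod_eq_zero hs (Channel.output_eq_zero _ hγ0 hγ hv hv' h0)

end

variable [DecidableEq ι]

/-- The probability of the transcript `y` for a uniformly random vector of signs. -/
noncomputable def mixProb (W : ∀ t, (Fin t → Y) → Channel (Bool × ι) Y) (γ : ℝ) (t : ℕ)
    (y : Fin t → Y) : ℝ :=
  (∑ z, pathProb W γ (signVec z) t y) / Fintype.card (ι → Bool)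

/-- The conditional expectation of a uniformly random vector of signs given the transcript `y`. -/
noncomputable def posteriorMean (W : ∀ t, (Fin t → Y) → Channel (Bool × ι) Y) (γ : ℝ) (t : ℕ)
    (y : Fin t → Y) (i : ι) : ℝ :=
  (∑ z, signVec z i * pathProb W γ (signVec z) t y) / ∑ z, pathProb W γ (signVec z) t y

lemma sum_mixProb [Nonempty ι] (γ : ℝ) (t : ℕ) : ∑ y, mixProb W γ t y = 1 := by
  simp only [mixProb]
  rw [← Finset.sum_div, Finset.sum_comm]
  simp [sum_pathProb]

section

variable (hγ0 : 0 ≤ γ) (hγ : γ ≤ 1 / 2)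
include hγ0 hγ

lemma mixProb_nonneg (t : ℕ) (y : Fin t → Y) : 0 ≤ mixProb W γ t y :=
  div_nonneg (Finset.sum_nonneg fun z _ => pathProb_nonneg W hγ0 hγ (abs_signVec_le z) t y)
    (by positivity)

lemma mixProb_eq_zero {t : ℕ} {y : Fin t → Y} (h : pathProb W γ 0 t y = 0) :
    mixProb W γ t y = 0 := by
  simp [mixProb, pathProb_eq_zero W hγ0 hγ (abs_signVec_le _) (v' := 0) (by simp) h]

lemma abs_posteriorMean_le (t : ℕ) (y : Fin t → Y) (i : ι) : |posteriorMean W γ t y i| ≤ 1 := by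
  have h0 := fun z => pathProb_nonneg W hγ0 hγ (abs_signVec_le z) t y
  rw [posteriorMean, abs_div, abs_of_nonneg (Finset.sum_nonneg fun z _ => h0 z)]
  refine div_le_one_of_le₀ ((Finset.abs_sum_le_sum_abs _ _).trans (Finset.sum_le_sum fun z _ => ?_))
    (Finset.sum_nonneg fun z _ => h0 z)
  rw [abs_mul, abs_of_nonneg (h0 z)]
  exact mul_le_of_le_one_left (h0 z) (abs_signVec_le z i)

lemma sum_pathProb_mul_posteriorMean (t : ℕ) (y : Fin t → Y) (i : ι) :
    (∑ z, pathProb W γ (signVec z) t y) * posteriorMean W γ t y i =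
      ∑ z, signVec z i * pathProb W γ (signVec z) t y := by
  rcases eq_or_ne (∑ z, pathProb W γ (signVec z) t y) 0 with h | h
  -- On a transcript of probability zero the right side vanishes termwise.
  · have h1 := (Finset.sum_eq_zero_iff_of_nonneg fun z _ =>
      pathProb_nonneg W hγ0 hγ (abs_signVec_le z) t y).1 h
    rw [h, zero_mul, Finset.sum_eq_zero fun z hz => by rw [h1 z hz, mul_zero]]
  · rw [posteriorMean, mul_div_cancel₀ _ h]

/-- Since `Channel.output` is affine in `v`, averaging it over the posterior amounts to evaluating
it at the posterior mean. -/
lemma mixProb_snoc (t : ℕ) (y : Fin t → Y) (c : Y) :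
    mixProb W γ (t + 1) (Fin.snoc y c) =
      mixProb W γ t y * (W t y).output γ (posteriorMean W γ t y) c := by
  rw [mixProb, mixProb, div_mul_eq_mul_div]
  congr 1
  simp only [pathProb_snoc, Channel.output, Finset.mul_sum]
  rw [Finset.sum_comm]
  refine Finset.sum_congr rfl fun i _ => ?_
  calc ∑ z, pathProb W γ (signVec z) t y *
        ((W t y).pairMass i c + γ * signVec z i * (W t y).pairDiff i c)
      = (∑ z, pathProb W γ (signVec z) t y) * (W t y).pairMass i c +
          γ * (W t y).pairDiff i c * ∑ z, signVec z i * pathProb W γ (signVec z) t y := by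
        rw [Finset.sum_mul, Finset.mul_sum, ← Finset.sum_add_distrib]
        exact Finset.sum_congr rfl fun z _ => by ring
    _ = _ := by
        rw [← sum_pathProb_mul_posteriorMean W hγ0 hγ]
        ring

variable [Nonempty ι]

/-- The divergences between the laws of the transcript for sign vectors that differ at a single
coordinate, summed over the coordinates. -/
lemma sum_klSum_flipAt_le (z : ι → Bool) (t : ℕ) :
    ∑ i, klSum (pathProb W γ (signVec z) t) (pathProb W γ (signVec (flipAt z i)) t) ≤
      t * (8 * γ ^ 2 * Fintype.card Y / Fintype.card ι) := by
  induction t with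
  | zero => simp [klSum, pathProb]
  | succ t ih =>
    have hz := abs_signVec_le z
    have hf := fun i => abs_signVec_le (flipAt z i)
    calc _ ≤ ∑ i, (klSum (pathProb W γ (signVec z) t) (pathProb W γ (signVec (flipAt z i)) t) +
          ∑ y, pathProb W γ (signVec z) t y * ∑ c, ((W t y).output γ (signVec z) c -
            (W t y).output γ (signVec (flipAt z i)) c) ^ 2 /
              (W t y).output γ (signVec (flipAt z i)) c) := by
          refine Finset.sum_le_sum fun i _ => klSum_snoc_le (pathProb_snoc W γ _ t)
            (pathProb_snoc W γ _ t) (pathProb_nonneg W hγ0 hγ hz t)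
            (pathProb_nonneg W hγ0 hγ (hf i) t)
            (fun _ => pathProb_eq_zero W hγ0 hγ hz (hf i))
            (fun y => Channel.output_nonneg _ hγ0 hγ hz)
            (fun y => Channel.output_nonneg _ hγ0 hγ (hf i))
            (fun y c => Channel.output_eq_zero _ hγ0 hγ hz (hf i))
            (fun y => Channel.sum_output _ _ _) (fun y => Channel.sum_output _ _ _)
      _ ≤ t * (8 * γ ^ 2 * Fintype.card Y / Fintype.card ι) +
          ∑ y, pathProb W γ (signVec z) t y * (8 * γ ^ 2 * Fintype.card Y / Fintype.card ι) := by
          rw [Finset.sum_add_distrib, Finset.sum_comm (s := Finset.univ (α := ι))]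
          simp only [← Finset.mul_sum]
          refine add_le_add ih (Finset.sum_le_sum fun y _ => ?_)
          exact mul_le_mul_of_nonneg_left (Channel.sum_chiSq_flipAt_le _ hγ0 hγ z)
            (pathProb_nonneg W hγ0 hγ hz t y)
      _ = _ := by
          rw [← Finset.sum_mul, sum_pathProb]
          push_cast
          ring

omit [Nonempty ι] in
-- Pairing `z` with its flip at `i` turns the unnormalized posterior mean into half a signed sum of
-- differences; Cauchy–Schwarz with weights `p z + p (flipAt z i)` then applies.
lemma mixProb_mul_sq_posteriorMean_le (t : ℕ) (y : Fin t → Y) (i : ι) :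
    mixProb W γ t y * posteriorMean W γ t y i ^ 2 ≤
      (∑ z, (pathProb W γ (signVec z) t y - pathProb W γ (signVec (flipAt z i)) t y) ^ 2 /
        (pathProb W γ (signVec z) t y + pathProb W γ (signVec (flipAt z i)) t y)) / 2 /
          Fintype.card (ι → Bool) := by
  set p : (ι → Bool) → ℝ := fun z => pathProb W γ (signVec z) t y with hp
  have hp0 : ∀ z, 0 ≤ p z := fun z => pathProb_nonneg W hγ0 hγ (abs_signVec_le z) t y
  set D := ∑ z, (p z - p (flipAt z i)) ^ 2 / (p z + p (flipAt z i)) with hD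
  have hflip : ∀ f : (ι → Bool) → ℝ, ∑ z, f (flipAt z i) = ∑ z, f z := fun f =>
    Equiv.sum_comp (flipAt_involutive i).toPerm f
  have hM : 0 ≤ ∑ z, p z := Finset.sum_nonneg fun z _ => hp0 z
  have hD0 : 0 ≤ D := Finset.sum_nonneg fun z _ =>
    div_nonneg (sq_nonneg _) (add_nonneg (hp0 _) (hp0 _))
  have h1 : (∑ z, p z) * posteriorMean W γ t y i =
      (∑ z, signVec z i * (p z - p (flipAt z i))) / 2 := by
    rw [sum_pathProb_mul_posteriorMean W hγ0 hγ]
    have h2 : ∑ z, signVec z i * p (flipAt z i) = -∑ z, signVec z i * p z := by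
      rw [← hflip fun z => signVec z i * p z, ← Finset.sum_neg_distrib]
      refine Finset.sum_congr rfl fun z _ => ?_
      simp [signVec, flipAt, boolSign_not]
    simp only [mul_sub, Finset.sum_sub_distrib]
    rw [h2]
    simp only [hp]
    ring
  have h3 : (∑ z, signVec z i * (p z - p (flipAt z i))) ^ 2 ≤ D * (2 * ∑ z, p z) := by
    have h4 : ∑ z, (p z + p (flipAt z i)) = 2 * ∑ z, p z := by
      rw [Finset.sum_add_distrib, hflip p]
      ring
    rw [← h4]
    refine Finset.sum_sq_le_sum_mul_sum_of_sq_le_mul _ (fun z _ => ?_) (fun z _ => ?_)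
      (fun z _ => ?_)
    · exact div_nonneg (sq_nonneg _) (add_nonneg (hp0 _) (hp0 _))
    · exact add_nonneg (hp0 _) (hp0 _)
    · have h5 : signVec z i ^ 2 = 1 := by rw [← sq_abs, signVec, abs_boolSign, one_pow]
      rw [mul_pow, h5, one_mul]
      rcases eq_or_ne (p z + p (flipAt z i)) 0 with h0 | h0
      · have ha : p z = 0 := by linarith [hp0 z, hp0 (flipAt z i)]
        have hb : p (flipAt z i) = 0 := by linarith [hp0 z, hp0 (flipAt z i)]
        simp [ha, hb]
      · rw [div_mul_cancel₀ _ h0]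
  have h6 : (∑ z, p z) * posteriorMean W γ t y i ^ 2 ≤ D / 2 := by
    rcases hM.eq_or_lt with h0 | h0
    · rw [← h0, zero_mul]
      positivity
    · refine le_of_mul_le_mul_left ?_ h0
      calc (∑ z, p z) * ((∑ z, p z) * posteriorMean W γ t y i ^ 2)
          = ((∑ z, p z) * posteriorMean W γ t y i) ^ 2 := by ring
        _ ≤ _ := by
          rw [h1]
          linarith
  rw [mixProb, div_mul_eq_mul_div]
  gcongr

lemma sum_mixProb_mul_sq_posteriorMean_le (t : ℕ) :
    ∑ y, mixProb W γ t y * ∑ i, posteriorMean W γ t y i ^ 2 ≤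
      t * (8 * γ ^ 2 * Fintype.card Y / Fintype.card ι) := by
  calc _ ≤ ∑ y, ∑ i, (∑ z, (pathProb W γ (signVec z) t y -
            pathProb W γ (signVec (flipAt z i)) t y) ^ 2 /
          (pathProb W γ (signVec z) t y + pathProb W γ (signVec (flipAt z i)) t y)) / 2 /
            Fintype.card (ι → Bool) := by
        refine Finset.sum_le_sum fun y _ => ?_
        rw [Finset.mul_sum]
        exact Finset.sum_le_sum fun i _ => mixProb_mul_sq_posteriorMean_le W hγ0 hγ t y i
    _ = (∑ z, ∑ i, (∑ y, (pathProb W γ (signVec z) t y -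
            pathProb W γ (signVec (flipAt z i)) t y) ^ 2 /
          (pathProb W γ (signVec z) t y + pathProb W γ (signVec (flipAt z i)) t y)) / 2) /
            Fintype.card (ι → Bool) := by
        simp only [Finset.sum_div]
        rw [Finset.sum_comm, Finset.sum_comm (s := Finset.univ (α := ι → Bool))]
        exact Finset.sum_congr rfl fun i _ => Finset.sum_comm
    _ ≤ (∑ _z : ι → Bool, t * (8 * γ ^ 2 * Fintype.card Y / Fintype.card ι)) /
            Fintype.card (ι → Bool) := by
        gcongr with z
        -- The division by `2` absorbs the `2` in front of `klSum`.
        refine (Finset.sum_le_sum fun i _ => ?_).trans (sum_klSum_flipAt_le W hγ0 hγ z t)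
        have := sum_sq_sub_div_add_le_two_mul_klSum
          (pathProb_nonneg W hγ0 hγ (abs_signVec_le z) t)
          (pathProb_nonneg W hγ0 hγ (abs_signVec_le (flipAt z i)) t)
          (fun _ => pathProb_eq_zero W hγ0 hγ (abs_signVec_le z) (abs_signVec_le (flipAt z i)))
          ((sum_pathProb W γ _ t).trans (sum_pathProb W γ _ t).symm)
        linarith
    _ = _ := by
        rw [Finset.sum_const, Finset.card_univ, nsmul_eq_mul]
        field_simp

/-- The divergence between the laws of the transcript for a uniformly random vector of signs and
for uniform inputs. -/
lemma klSum_mixProb_le (t : ℕ) :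
    klSum (mixProb W γ t) (pathProb W γ 0 t) ≤
      4 * γ ^ 4 * t ^ 2 * Fintype.card Y / (Fintype.card ι : ℝ) ^ 2 := by
  have h0 : ∀ i : ι, |(0 : ι → ℝ) i| ≤ 1 := by simp
  induction t with
  | zero => simp [klSum, pathProb, mixProb]
  | succ t ih =>
    have hstep := klSum_snoc_le (mixProb_snoc W hγ0 hγ t) (pathProb_snoc W γ 0 t)
      (mixProb_nonneg W hγ0 hγ t) (pathProb_nonneg W hγ0 hγ h0 t)
      (fun _ => mixProb_eq_zero W hγ0 hγ)
      (fun y => Channel.output_nonneg _ hγ0 hγ (abs_posteriorMean_le W hγ0 hγ t y))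
      (fun y => Channel.output_nonneg _ hγ0 hγ h0)
      (fun y c => Channel.output_eq_zero _ hγ0 hγ (abs_posteriorMean_le W hγ0 hγ t y) h0)
      (fun y => Channel.sum_output _ _ _) (fun y => Channel.sum_output _ _ _)
    have hsum : ∑ y, mixProb W γ t y * ∑ c, ((W t y).output γ (posteriorMean W γ t y) c -
        (W t y).output γ 0 c) ^ 2 / (W t y).output γ 0 c ≤
        γ ^ 2 / Fintype.card ι * (t * (8 * γ ^ 2 * Fintype.card Y / Fintype.card ι)) := by
      calc _ ≤ ∑ y, mixProb W γ t y *
            (γ ^ 2 / Fintype.card ι * ∑ i, posteriorMean W γ t y i ^ 2) :=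
            Finset.sum_le_sum fun y _ => mul_le_mul_of_nonneg_left
              (Channel.sum_sq_output_sub_div_le _ γ _) (mixProb_nonneg W hγ0 hγ t y)
        _ = γ ^ 2 / Fintype.card ι * ∑ y, mixProb W γ t y * ∑ i, posteriorMean W γ t y i ^ 2 := by
            rw [Finset.mul_sum]
            exact Finset.sum_congr rfl fun y _ => by ring
        _ ≤ _ := by
            gcongr
            exact sum_mixProb_mul_sq_posteriorMean_le W hγ0 hγ t
    calc _ ≤ 4 * γ ^ 4 * t ^ 2 * Fintype.card Y / (Fintype.card ι : ℝ) ^ 2 +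
          γ ^ 2 / Fintype.card ι * (t * (8 * γ ^ 2 * Fintype.card Y / Fintype.card ι)) :=
          hstep.trans (add_le_add ih hsum)
      -- The new user costs `8 t γ⁴`, that is `4 γ⁴ * 2t`, and `t² + 2t ≤ (t + 1)²` closes the
      -- induction.
      _ = 4 * γ ^ 4 * (t ^ 2 + 2 * t) * Fintype.card Y / (Fintype.card ι : ℝ) ^ 2 := by
          field_simp
          ring
      _ ≤ _ := by
          gcongr
          push_cast
          nlinarith

end

end Paths

/-! ### From protocols and tests to transcript laws -/

section Reduction

variable {ι X Y : Type*} [Fintype ι] [Fintype X] [Fintype Y]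

/-- The channel `W` with its inputs relabelled by `f`. -/
def Channel.comap {X' : Type*} (W : Channel X Y) (f : X' → X) : Channel X' Y where
  prob x := W.prob (f x)
  prob_mem x := W.prob_mem (f x)

/-- The channel with a constant output. -/
def Channel.const (X : Type*) [DecidableEq Y] (c : Y) : Channel X Y where
  prob _ := Pi.single c 1
  prob_mem _ := single_mem_stdSimplex ℝ c

/-- For a fixed transcript and fixed coins every channel is determined, so independence of the
inputs makes the sum factor over the users. -/
lemma InteractiveProtocol.transcriptProb_eq_prod {𝒲 : Set (Channel X Y)} {n : ℕ} {U : Type*}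
    [MeasurableSpace U] (P : InteractiveProtocol 𝒲 n U) (p : X → ℝ) (c : U) (y : Fin n → Y) :
    P.transcriptProb p c y =
      ∏ t, ∑ x, p x * (P.channel t (pastMessages y t) c).prob x (y t) := by
  classical
  rw [transcriptProb, Finset.prod_univ_sum, Fintype.piFinset_univ]
  exact Finset.sum_congr rfl fun x _ => Finset.prod_mul_distrib.symm

lemma InteractiveProtocol.measurable_transcriptProb {𝒲 : Set (Channel X Y)} {n : ℕ} {U : Type*}
    [MeasurableSpace U] (P : InteractiveProtocol 𝒲 n U) (p : X → ℝ) (y : Fin n → Y) :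
    Measurable fun c => P.transcriptProb p c y := by
  unfold transcriptProb
  exact Finset.measurable_sum _ fun x _ =>
    (Finset.measurable_prod _ fun t _ => P.measurable_prob t _ _ _).const_mul _

/-- The channels selected by a protocol for given public coins, with inputs relabelled by pairs and
extended by a trivial channel to all later users. -/
noncomputable def InteractiveProtocol.kernel [Nonempty Y] {𝒲 : Set (Channel X Y)} {n : ℕ}
    {U : Type*} [MeasurableSpace U] (P : InteractiveProtocol 𝒲 n U) (e : Bool × ι ≃ X) (c : U)
    (t : ℕ) (past : Fin t → Y) : Channel (Bool × ι) Y :=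
  open Classical in
  if h : t < n then (P.channel ⟨t, h⟩ past c).comap e else Channel.const _ (Classical.arbitrary Y)

lemma InteractiveProtocol.transcriptProb_perturbed [Nonempty Y] {𝒲 : Set (Channel X Y)} {n : ℕ}
    {U : Type*} [MeasurableSpace U] (P : InteractiveProtocol 𝒲 n U) (e : Bool × ι ≃ X) (γ : ℝ)
    (v : ι → ℝ) (c : U) (y : Fin n → Y) :
    P.transcriptProb (perturbed γ v ∘ e.symm) c y = pathProb (P.kernel e c) γ v n y := by
  rw [transcriptProb_eq_prod, pathProb]
  refine Finset.prod_congr rfl fun t _ => ?_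
  rw [← Channel.sum_perturbed_mul_prob, ← e.sum_comp]
  refine Finset.sum_congr rfl fun x _ => ?_
  simp [kernel, Channel.comap]

lemma card_eq_two_mul_of_equiv (e : Bool × ι ≃ X) : Fintype.card X = 2 * Fintype.card ι := by
  rw [← Fintype.card_congr e, Fintype.card_prod, Fintype.card_bool]

lemma uniformDist_eq_perturbed (e : Bool × ι ≃ X) (γ : ℝ) :
    uniformDist X = perturbed γ 0 ∘ e.symm := by
  funext x
  simp [uniformDist, perturbed, card_eq_two_mul_of_equiv e]

lemma perturbed_mem_stdSimplex [Nonempty ι] (e : Bool × ι ≃ X) {γ : ℝ} (hγ0 : 0 ≤ γ) (hγ : γ ≤ 1)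
    (z : ι → Bool) : perturbed γ (signVec z) ∘ e.symm ∈ stdSimplex ℝ X := by
  constructor
  · intro x
    refine div_nonneg ?_ (by positivity)
    have h : |γ * boolSign (e.symm x).1 * signVec z (e.symm x).2| ≤ 1 := by
      rw [abs_mul, abs_mul, abs_boolSign, signVec, abs_boolSign, abs_of_nonneg hγ0]
      linarith
    linarith [(abs_le.1 h).1]
  · simp only [Function.comp_apply]
    rw [e.symm.sum_comp (perturbed γ (signVec z)), Fintype.sum_prod_type_right]
    have h : ∀ i : ι, ∑ b, perturbed γ (signVec z) (b, i) = 1 / Fintype.card ι := by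
      intro i
      simp [perturbed, boolSign]
      ring
    rw [Finset.sum_congr rfl fun i _ => h i]
    simp

lemma half_le_tvDist_perturbed [Nonempty ι] (e : Bool × ι ≃ X) (γ : ℝ) (z : ι → Bool) :
    γ / 2 ≤ tvDist (perturbed γ (signVec z) ∘ e.symm) (uniformDist X) := by
  -- The witness set takes from each pair the element whose mass increases; each pair gains `γ / (2
  -- * card ι)`.
  let f : ι ↪ X := ⟨fun i => e (z i, i), fun i j h => (Prod.ext_iff.1 (e.injective h)).2⟩
  have h : ∀ b, boolSign b * boolSign b = 1 := by
    intro b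
    cases b <;> simp [boolSign]
  refine le_trans (le_of_eq ?_) (le_ciSup (Set.finite_range _).bddAbove (Finset.univ.map f))
  rw [uniformDist_eq_perturbed e γ, ← Finset.sum_sub_distrib, Finset.sum_map]
  have hf : ∀ i, (perturbed γ (signVec z) ∘ e.symm) (f i) - (perturbed γ 0 ∘ e.symm) (f i) =
      γ / (2 * Fintype.card ι) := by
    intro i
    have he : e.symm (f i) = (z i, i) := e.symm_apply_apply _
    simp only [Function.comp_apply, he, perturbed, signVec, mul_assoc, h, Pi.zero_apply]
    ring
  rw [Finset.sum_congr rfl fun i _ => hf i, Finset.sum_const, Finset.card_univ, nsmul_eq_mul]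
  field_simp

/-- The probability of the decision `b` given the public coins. -/
noncomputable def condDecisionProb {𝒲 : Set (Channel X Y)} {n : ℕ} {U : Type*} [MeasurableSpace U]
    (P : InteractiveProtocol 𝒲 n U) (T : DecisionFunction Y n U) (p : X → ℝ) (b : Bool) (c : U) :
    ℝ :=
  ∑ y : Fin n → Y, P.transcriptProb p c y * (T.decide c).prob y b

lemma integrable_condDecisionProb {𝒲 : Set (Channel X Y)} {n : ℕ} {U : Type*} [MeasurableSpace U]
    (μ : Measure U) [IsFiniteMeasure μ] (P : InteractiveProtocol 𝒲 n U)
    (T : DecisionFunction Y n U) (p : X → ℝ) (b : Bool) :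
    Integrable (condDecisionProb P T p b) μ := by
  refine integrable_finsetSum _ fun y _ => ?_
  refine Integrable.of_bound (C := ∑ x : Fin n → X, |∏ t, p (x t)|)
    ((P.measurable_transcriptProb p y).mul (T.measurable_prob y b)).aestronglyMeasurable
    (Filter.Eventually.of_forall fun c => ?_)
  have h1 : |P.transcriptProb p c y| ≤ ∑ x : Fin n → X, |∏ t, p (x t)| := by
    refine (Finset.abs_sum_le_sum_abs _ _).trans (Finset.sum_le_sum fun x _ => ?_)
    rw [abs_mul]
    refine mul_le_of_le_one_right (abs_nonneg _) ?_
    rw [abs_of_nonneg (Finset.prod_nonneg fun t _ => (Channel.prob_mem _ _).1 _)]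
    exact Finset.prod_le_one (fun t _ => (Channel.prob_mem _ _).1 _)
      fun t _ => Channel.prob_le_one _ _ _
  rw [Real.norm_eq_abs, abs_mul, abs_of_nonneg ((Channel.prob_mem _ _).1 _)]
  exact (mul_le_of_le_one_right (abs_nonneg _) (Channel.prob_le_one _ _ _)).trans h1

/-- For few users, the acceptance probability under the uniform distribution and the average
rejection probability under the perturbed distributions cannot both be close to `1`. -/
lemma condDecisionProb_add_average_le [DecidableEq ι] [Nonempty ι] [Nonempty Y]
    {𝒲 : Set (Channel X Y)} {n : ℕ} {U : Type*} [MeasurableSpace U]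
    (P : InteractiveProtocol 𝒲 n U) (T : DecisionFunction Y n U) (e : Bool × ι ≃ X) {γ : ℝ}
    (hγ0 : 0 ≤ γ) (hγ : γ ≤ 1 / 2)
    (hn : 4 * γ ^ 4 * n ^ 2 * Fintype.card Y / (Fintype.card ι : ℝ) ^ 2 ≤ 1 / 16) (c : U) :
    condDecisionProb P T (uniformDist X) false c +
        (∑ z : ι → Bool, condDecisionProb P T (perturbed γ (signVec z) ∘ e.symm) true c) /
          Fintype.card (ι → Bool) ≤ 3 / 2 := by
  have hT : ∀ y, (T.decide c).prob y true = 1 - (T.decide c).prob y false := by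
    intro y
    have := ((T.decide c).prob_mem y).2
    rw [Fintype.sum_bool] at this
    linarith
  set W := P.kernel e c
  have havg : (∑ z : ι → Bool, condDecisionProb P T (perturbed γ (signVec z) ∘ e.symm) true c) /
      Fintype.card (ι → Bool) = 1 - ∑ y, mixProb W γ n y * (T.decide c).prob y false := by
    simp only [condDecisionProb, InteractiveProtocol.transcriptProb_perturbed, hT]
    rw [Finset.sum_comm, Finset.sum_div]
    calc _ = ∑ y, mixProb W γ n y * (1 - (T.decide c).prob y false) := by
          refine Finset.sum_congr rfl fun y _ => ?_
          rw [mixProb, ← Finset.sum_mul]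
          ring
      _ = _ := by
          simp only [mul_sub, mul_one, Finset.sum_sub_distrib, sum_mixProb]
  -- The threshold `1/16` makes the squared gap at most `4 * (1/16) = (1/2)²`.
  have hkl := (sq_sum_sub_mul_le_four_mul_klSum (mixProb_nonneg W hγ0 hγ n)
    (pathProb_nonneg W hγ0 hγ (v := 0) (by simp) n) (fun _ => mixProb_eq_zero W hγ0 hγ)
    (sum_mixProb W γ n) (sum_pathProb W γ 0 n) (fun y => ((T.decide c).prob_mem y).1 false)
    (fun y => Channel.prob_le_one _ y false)).trans
    (mul_le_mul_of_nonneg_left ((klSum_mixProb_le W hγ0 hγ n).trans hn) (by norm_num))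
  have hle : ∑ y, (pathProb W γ 0 n y - mixProb W γ n y) * (T.decide c).prob y false ≤ 1 / 2 := by
    refine (abs_le_of_sq_le_sq' (hkl.trans ?_) (by norm_num)).2
    norm_num
  rw [havg, condDecisionProb, uniformDist_eq_perturbed e γ]
  simp only [InteractiveProtocol.transcriptProb_perturbed]
  simp only [sub_mul, Finset.sum_sub_distrib] at hle
  linarith

/-- The choice `γ = 2ε` places every perturbation at distance at least `ε`. Otherwise integrating
the bound `3/2` over the coins would contradict two probabilities of at least `99/100`. -/
lemma IsUniformityTest.lt_of_equiv [DecidableEq ι] [Nonempty ι] [Nonempty Y]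
    {𝒲 : Set (Channel X Y)} {n : ℕ} {U : Type*} [MeasurableSpace U] {μ : Measure U}
    [IsProbabilityMeasure μ] {P : InteractiveProtocol 𝒲 n U} {T : DecisionFunction Y n U} {ε : ℝ}
    (h : IsUniformityTest μ P T ε) (e : Bool × ι ≃ X) (hε0 : 0 < ε) (hε : ε ≤ 1 / 4) :
    1 / 16 < 4 * (2 * ε) ^ 4 * n ^ 2 * Fintype.card Y / (Fintype.card ι : ℝ) ^ 2 := by
  by_contra! hn
  have hpt := condDecisionProb_add_average_le P T e (by linarith) (by linarith) hn
  have hint1 := integrable_condDecisionProb μ P T (uniformDist X) false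
  have hint2 := fun z : ι → Bool =>
    integrable_condDecisionProb μ P T (perturbed (2 * ε) (signVec z) ∘ e.symm) true
  have hsum := integrable_finsetSum Finset.univ fun z _ => hint2 z
  have hle := integral_mono (hint1.add (hsum.div_const _)) (integrable_const (3 / 2 : ℝ)) hpt
  rw [integral_add' hint1 (hsum.div_const _), integral_div,
    integral_finsetSum _ fun z _ => hint2 z, integral_const] at hle
  simp only [probReal_univ, smul_eq_mul, one_mul] at hle
  have h1 : 99 / 100 ≤ ∫ c, condDecisionProb P T (uniformDist X) false c ∂μ := h.1
  have h2 : 99 / 100 ≤ (∑ z : ι → Bool,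
      ∫ c, condDecisionProb P T (perturbed (2 * ε) (signVec z) ∘ e.symm) true c ∂μ) /
        Fintype.card (ι → Bool) := by
    rw [le_div_iff₀ (by positivity), mul_comm, ← nsmul_eq_mul, ← Finset.card_univ]
    refine Finset.card_nsmul_le_sum _ _ _ fun z _ => ?_
    refine h.2 _ (perturbed_mem_stdSimplex e (by linarith) (by linarith) z) ?_
    have := half_le_tvDist_perturbed e (2 * ε) z
    linarith
  linarith

end Reduction

/-! ### The sample complexity bound -/

/-- The number of users of a uniformity test is at least `k / (32 ε² 2 ^ (ℓ / 2))`. -/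
lemma IsUniformityTest.le_card_users {k ℓ n : ℕ} {ε : ℝ} {U : Type*} [MeasurableSpace U]
    {μ : Measure U} [IsProbabilityMeasure μ] {P : InteractiveProtocol (commChannels k ℓ) n U}
    {T : DecisionFunction (Fin ℓ → Bool) n U} (h : IsUniformityTest μ P T ε) (hk : 0 < k)
    (hε0 : 0 < ε) (hε : ε ≤ 1 / 4) :
    1 / 32 * ((k : ℝ) / (ε ^ 2 * (2 : ℝ) ^ ((ℓ : ℝ) / 2))) ≤ n := by
  have : Nonempty (Fin k) := ⟨⟨0, hk⟩⟩
  have hlt := h.lt_of_equiv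
    ((finTwoEquiv.symm.prodCongr (Equiv.refl (Fin k))).trans finProdFinEquiv) hε0 hε
  have hk' : (0 : ℝ) < k := by exact_mod_cast hk
  set r := (2 : ℝ) ^ ((ℓ : ℝ) / 2) with hr
  have hr0 : 0 < r := by positivity
  have hrr : r ^ 2 = 2 ^ ℓ := by
    rw [hr, ← Real.rpow_natCast, ← Real.rpow_mul (by norm_num), ← Real.rpow_natCast]
    congr 1
    push_cast
    ring
  simp only [Fintype.card_pi, Fintype.card_bool, Finset.prod_const, Finset.card_univ,
    Fintype.card_fin] at hlt
  push_cast at hlt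
  rw [← hrr, lt_div_iff₀ (by positivity)] at hlt
  -- The constant `32` is the square root of `16 * 4 * 2 ^ 4`.
  have h1 : (k : ℝ) ^ 2 ≤ (32 * (ε ^ 2 * r) * n) ^ 2 := by
    calc (k : ℝ) ^ 2 ≤ 16 * (4 * (2 * ε) ^ 4 * n ^ 2 * r ^ 2) := by linarith
      _ = _ := by ring
  have h2 := le_of_sq_le_sq h1 (by positivity)
  rw [← mul_div_assoc, div_le_iff₀ (by positivity)]
  linarith

theorem mainTheorem11 :
    ∃ C : ℝ, 0 < C ∧ ∀ (k ℓ : ℕ) (ε : ℝ),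
      1 ≤ ℓ → (ℓ : ℝ) ≤ Real.logb 2 (k : ℝ) → 0 < ε → ε ≤ 1 / 4 →
      ENNReal.ofReal (C * ((k : ℝ) / (ε ^ 2 * (2 : ℝ) ^ ((ℓ : ℝ) / 2)))) ≤
        ((uniformitySampleComplexity.{u} (commChannels k ℓ) ε : ℕ∞) : ℝ≥0∞) := by
  refine ⟨1 / 32, by norm_num, fun k ℓ ε hℓ hℓk hε0 hε => ?_⟩
  -- For `k = 0` the convention `Real.logb 2 0 = 0` contradicts `1 ≤ ℓ`.
  have hk : 0 < k := by
    rcases Nat.eq_zero_or_pos k with rfl | hk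
    · have : (1 : ℝ) ≤ ℓ := by exact_mod_cast hℓ
      simp at hℓk
      linarith
    · exact hk
  unfold uniformitySampleComplexity
  set A : Set ℕ := {n : ℕ | ∃ (U : Type u) (_ : MeasurableSpace U) (μ : Measure U)
    (_ : IsProbabilityMeasure μ) (P : InteractiveProtocol (commChannels k ℓ) n U)
    (T : DecisionFunction (Fin ℓ → Bool) n U), IsUniformityTest μ P T ε}
  rcases A.eq_empty_or_nonempty with hA | hA
  · simp [hA]
  obtain ⟨n, ⟨U, _, μ, _, P, T, hT⟩, hn⟩ := csInf_mem (hA.image fun n : ℕ => (n : ℕ∞))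
  rw [← hn, ENat.toENNReal_coe, ← ENNReal.ofReal_natCast]
  exact ENNReal.ofReal_le_ofReal (hT.le_card_users hk hε0 hε)
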